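/- Let $m\ge 2$ and $n\ge 1$ be integers, and let $r_1,\dots,r_n\ge 1$. The resultant $\mathrm{Res}_{r_1,\dots,r_n}$ is the polynomial with complex coefficients, in the coefficients of a system $h=(h_1,\dots,h_n)$ of homogeneous polynomials in $\mathbb{C}[x_1,\dots,x_n]$ with $h_i$ of degree $r_i$ (the zero polynomial being allowed), such that it is irreducible, it vanishes at $h$ if and only if $h_1=\cdots=h_n=0$ has a solution in $\mathbb{C}^n\setminus\{0\}$, and $\mathrm{Res}(x_1^{r_1},\dots,x_n^{r_n})=1$. For an $m$-th order $n$-dimensional complex tensor $\mathcal{T}=(t_{i_1\ldots i_m})_{1\le i_1,\dots,i_m\le n}$, the E-determinant $\mathrm{Edet}(\mathcal{T})$ is the resultant (for $r_1=\dots=r_n=m-1$) of the system $\mathcal{T}\mathbf{x}^{m-1}$, whose $i$-th member is $\sum_{i_2,\dots,i_m=1}^n t_{i i_2\ldots i_m}x_{i_2}\cdots x_{i_m}$. Theorem. Let $m,n\ge 2$, let $\mathcal{T}$ be an $m$-th order $n$-dimensional complex tensor, and let $k$ be an integer with $1\le k\le n-1$ such that $t_{i i_2\ldots i_m}=0$ for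 every $i\in\{k+1,\dots,n\}$ and all $i_2,\dots,i_m\in\{1,\dots,n\}$ with $\{i_2,\dots,i_m\}\cap\{1,\dots,k\}\neq\emptyset$. Let $\mathcal{U}=(t_{i_1\ldots i_m})_{1\le i_1,\dots,i_m\le k}$ and $\mathcal{V}=(t_{k+i_1,\ldots,k+i_m})_{1\le i_1,\dots,i_m\le n-k}$ be the sub-tensors of $\mathcal{T}$ associated to $\{1,\dots,k\}$ and $\{k+1,\dots,n\}$. Then the resultants defining $\mathrm{Edet}(\mathcal{T})$, $\mathrm{Edet}(\mathcal{U})$ and $\mathrm{Edet}(\mathcal{V})$ exist and are unique, and $$\mathrm{Edet}(\mathcal{T})=\bigl[\mathrm{Edet}(\mathcal{U})\bigr]^{(m-1)^{n-k}}\bigl[\mathrm{Edet}(\mathcal{V})\bigr]^{(m-1)^{k}}.$$ -/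

import Mathlib

namespace EDeterminant

noncomputable section

/-- Indices of the coefficients of a system `h₁, …, hₙ` of forms in `n` variables, where `hᵢ` has
degree `r i`: a number `i` of a form together with an exponent vector of total degree `r i`. -/
abbrev CoeffIndex {n : ℕ} (r : Fin n → ℕ) : Type :=
  Σ i : Fin n, {α : Fin n →₀ ℕ // α.degree = r i}

/-- The coefficients of the system `h`, as a point of the affine space of all systems of forms of
degrees `r`. -/
def systemCoeffs {n : ℕ} (r : Fin n → ℕ) (h : Fin n → MvPolynomial (Fin n) ℂ) : CoeffIndex r → ℂ :=
  fun c => (h c.1).coeff c.2.1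

/-- `R` is the resultant for systems of `n` forms in `n` variables of degrees `r`: it is an
irreducible polynomial in the coefficients of the system, it vanishes at a system exactly when the
system has a nontrivial zero, and it is normalized by `Res (x₁ ^ r₁, …, xₙ ^ rₙ) = 1`. -/
structure IsResultant {n : ℕ} (r : Fin n → ℕ) (R : MvPolynomial (CoeffIndex r) ℂ) : Prop where
  irreducible : Irreducible R
  eval_eq_zero_iff : ∀ h : Fin n → MvPolynomial (Fin n) ℂ, (∀ i, (h i).IsHomogeneous (r i)) →
    (MvPolynomial.eval (systemCoeffs r h) R = 0 ↔
      ∃ x : Fin n → ℂ, x ≠ 0 ∧ ∀ i, MvPolynomial.eval x (h i) = 0)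
  normalized : MvPolynomial.eval (systemCoeffs r fun i => MvPolynomial.X i ^ r i) R = 1

open Classical in
/-- The resultant polynomial for degrees `r` (with value `0` in case there is none). -/
def resultantPoly {n : ℕ} (r : Fin n → ℕ) : MvPolynomial (CoeffIndex r) ℂ :=
  if hr : ∃ R, IsResultant r R then hr.choose else 0

/-- The resultant `Res_{r₁, …, rₙ}(h)` of a system `h` of forms of degrees `r`. -/
def resultant {n : ℕ} (r : Fin n → ℕ) (h : Fin n → MvPolynomial (Fin n) ℂ) : ℂ :=
  MvPolynomial.eval (systemCoeffs r h) (resultantPoly r)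

/-- Complex tensors of dimension `n` and order `m ≥ 1`. The first index is kept apart: the entry
`t_{i i₂ … iₘ}` of `T` is `T i (i₂, …, iₘ)`. -/
abbrev Tensor (n m : ℕ) : Type := Fin n → (Fin (m - 1) → Fin n) → ℂ

/-- The system `T x^{m-1}`: its `i`-th member is the form
`∑_{i₂, …, iₘ} t_{i i₂ … iₘ} x_{i₂} ⋯ x_{iₘ}` of degree `m - 1`. -/
def Tensor.forms {n m : ℕ} (T : Tensor n m) (i : Fin n) : MvPolynomial (Fin n) ℂ :=
  ∑ j : Fin (m - 1) → Fin n, MvPolynomial.C (T i j) * ∏ l, MvPolynomial.X (j l)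

theorem Tensor.forms_isHomogeneous {n m : ℕ} (T : Tensor n m) (i : Fin n) :
    (T.forms i).IsHomogeneous (m - 1) := by
  refine MvPolynomial.IsHomogeneous.sum _ _ _ fun j _ => ?_
  have h := MvPolynomial.IsHomogeneous.prod (Finset.univ : Finset (Fin (m - 1)))
    (fun l => (MvPolynomial.X (j l) : MvPolynomial (Fin n) ℂ)) (fun _ => 1)
    (fun l _ => MvPolynomial.isHomogeneous_X ℂ (j l))
  simpa using (MvPolynomial.isHomogeneous_C (Fin n) (T i j)).mul h

/-- The E-determinant of `T`: the resultant of the system `T x^{m-1} = 0`. -/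
def Edet {n m : ℕ} (T : Tensor n m) : ℂ :=
  resultant (fun _ => m - 1) T.forms

/-- The sub-tensor of `T` on the indices `e 0, …, e (k - 1)`. -/
def Tensor.sub {n m k : ℕ} (T : Tensor n m) (e : Fin k → Fin n) : Tensor k m :=
  fun i j => T (e i) fun l => e (j l)

end

end EDeterminant

/-! The systems with a nontrivial zero form an irreducible hypersurface. Their vanishing ideal
`hasZeroIdeal` is prime because they are the image of an affine space (`zeroParam`). It is principal
because it is nonzero (`exists_macaulay`) but contains no nonzero polynomial free of the coefficient
of `xᵢ ^ rᵢ` in the `i`-th form (`eq_zero_of_rename_mem_hasZeroIdeal`). The normalized generator is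
the resultant.

On triangular systems a nontrivial zero yields one of a diagonal block. By the Nullstellensatz the
restricted resultant divides a power of the product of the block resultants, so unique factorization
makes it `z * RU ^ a * RV ^ b`. The system of powers gives `z = 1`. The exponents follow by scaling
one form: the resultant has degree `d ^ (n - 1)` in each form, at most that by Macaulay's
determinant, at least that by a cyclic system solvable at every `d ^ (n - 1)`-th root of unity. -/

namespace EDeterminant

open MvPolynomial

/-! ### Commutative algebra: Nullstellensatz, Krull's height theorem, Gauss's lemma. -/

section Algebra

theorem dvd_pow_of_eval_eq_zero_imp {σ K : Type*} [Finite σ] [Field K] [IsAlgClosed K]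
    {F G : MvPolynomial σ K} (h : ∀ x, eval x F = 0 → eval x G = 0) : ∃ N, F ∣ G ^ N := by
  have hG : G ∈ vanishingIdeal K (zeroLocus K (Ideal.span {F})) := by
    intro x hx
    have := hx F (Ideal.subset_span rfl)
    rw [MvPolynomial.aeval_eq_eval] at this ⊢
    exact h x this
  rw [vanishingIdeal_zeroLocus_eq_radical] at hG
  obtain ⟨N, hN⟩ := hG
  exact ⟨N, Ideal.mem_span_singleton.1 hN⟩

/-- If the origin were the only common zero, its maximal ideal would be minimal over the ideal of
`s`, and Krull's height theorem would bound its height by the size of `s`, below the dimension. -/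
theorem exists_ne_zero_forall_eval_eq_zero {σ K : Type*} [Finite σ] [Field K] [IsAlgClosed K]
    {s : Set (MvPolynomial σ K)} (hs : s.Finite) (hcard : s.ncard < Nat.card σ)
    (h0 : ∀ p ∈ s, eval 0 p = 0) : ∃ x : σ → K, x ≠ 0 ∧ ∀ p ∈ s, eval x p = 0 := by
  by_contra! hcon
  have hdim : ringKrullDim (MvPolynomial σ K) = Nat.card σ := by simp
  have : FiniteRingKrullDim (MvPolynomial σ K) :=
    finiteRingKrullDim_iff_ne_bot_and_top.2 ⟨by rw [hdim]; exact WithBot.coe_ne_bot, by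
      rw [hdim]; exact fun h => ENat.natCast_ne_top _ (WithBot.coe_injective h)⟩
  obtain ⟨P, hP, hht⟩ := Ideal.exists_isMaximal_height (R := MvPolynomial σ K)
  obtain ⟨a, rfl⟩ := isMaximal_iff_eq_vanishingIdeal_singleton.1 hP
  -- The maximal ideal of full height belongs to some unknown point `a`, so the system is translated
  -- from the origin to `a`.
  let τ : MvPolynomial σ K →ₐ[K] MvPolynomial σ K := aeval fun i => X i - C (a i)
  have hτ : ∀ (x : σ → K) p, eval x (τ p) = eval (x - a) p := by
    intro x p
    simp only [τ]
    induction p using MvPolynomial.induction_on with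
    | C c => simp
    | add p q hp hq => simp only [map_add, hp, hq]
    | mul_X p i hp => simp only [map_mul, hp]; simp
  have hmin : vanishingIdeal K {a} ∈ (Ideal.span (τ '' s)).minimalPrimes := by
    refine ⟨⟨hP.isPrime, Ideal.span_le.2 ?_⟩, ?_⟩
    · rintro _ ⟨p, hp, rfl⟩ x rfl
      rw [MvPolynomial.aeval_eq_eval]
      rw [hτ, sub_self, h0 p hp]
    · rintro Q ⟨hQ, hsQ⟩ -
      rw [← hQ.isRadical.radical, ← vanishingIdeal_zeroLocus_eq_radical (K := K)]
      refine vanishingIdeal_anti_mono fun x hx => ?_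
      by_contra hxa
      obtain ⟨p, hp, hpx⟩ := hcon (x - a) (sub_ne_zero.2 hxa)
      apply hpx
      have := hx _ (hsQ (Ideal.subset_span ⟨p, hp, rfl⟩))
      rw [MvPolynomial.aeval_eq_eval] at this
      rw [← hτ]
      exact this
  have hle := Ideal.height_le_card_of_mem_minimalPrimes_span (hs.image τ) hmin
  have hle2 : (Set.ncard (τ '' s) : ℕ∞) ≤ s.ncard := by exact_mod_cast Set.ncard_image_le hs
  have h3 : ((vanishingIdeal K {a}).height : WithBot ℕ∞) ≤ (s.ncard : ℕ∞) :=
    WithBot.coe_le_coe.2 (hle.trans hle2)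
  rw [hht, hdim] at h3
  have h4 : (Nat.card σ : ℕ∞) ≤ s.ncard := WithBot.coe_le_coe.1 h3
  exact absurd (by exact_mod_cast h4) (not_le.2 hcard)

/-- A prime element `R` of `J` has positive degree, so it is primitive. An element of `J` not
divisible by `R` would be coprime to it over the fraction field, and clearing denominators in the
Bézout identity would put a nonzero constant in `J`. -/
theorem exists_eq_span_irreducible_of_comap_C_eq_bot {B : Type*} [CommRing B] [IsDomain B]
    [UniqueFactorizationMonoid B] (J : Ideal (Polynomial B)) [hJ : J.IsPrime] (hne : J ≠ ⊥)
    (hC : ∀ b, Polynomial.C b ∈ J → b = 0) :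
    ∃ R, Irreducible R ∧ J = Ideal.span {R} := by
  classical
  let _ : NormalizedGCDMonoid B := Classical.choice inferInstance
  obtain ⟨R, hRJ, hR⟩ := hJ.exists_mem_prime_of_ne_bot hne
  refine ⟨R, hR.irreducible, le_antisymm (fun G hG => ?_) (by simpa [Ideal.span_le] using hRJ)⟩
  rw [Ideal.mem_span_singleton]
  have hdeg : R.natDegree ≠ 0 := by
    intro h0
    rw [Polynomial.eq_C_of_natDegree_eq_zero h0] at hRJ
    have := hC _ hRJ
    rw [Polynomial.eq_C_of_natDegree_eq_zero h0, this, Polynomial.C_0] at hR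
    exact hR.ne_zero rfl
  have hprim : R.IsPrimitive := hR.irreducible.isPrimitive hdeg
  let K := FractionRing B
  refine hprim.dvd_of_fraction_map_dvd_fraction_map (K := K) ?_
  by_contra hnd
  have hirr := (hprim.irreducible_iff_irreducible_map_fraction_map (K := K)).1 hR.irreducible
  obtain ⟨a, b, hab⟩ := (hirr.coprime_iff_not_dvd).2 hnd
  obtain ⟨c, hcm, hc⟩ := IsLocalization.integerNormalization_spec (nonZeroDivisors B) a
  obtain ⟨d, hdm, hd⟩ := IsLocalization.integerNormalization_spec (nonZeroDivisors B) b
  set a' := IsLocalization.integerNormalization (nonZeroDivisors B) a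
  set b' := IsLocalization.integerNormalization (nonZeroDivisors B) b
  have key : Polynomial.C (c * d) = Polynomial.C d * a' * R
      + Polynomial.C c * b' * G := by
    apply Polynomial.map_injective (algebraMap B K) (IsFractionRing.injective B K)
    simp only [Polynomial.map_add, Polynomial.map_mul, Polynomial.map_C, hc, hd, map_mul,
      Algebra.smul_def]
    simp only [Polynomial.algebraMap_apply]
    linear_combination (-Polynomial.C (algebraMap B K c) * Polynomial.C (algebraMap B K d)) * hab
  have hmem : Polynomial.C (c * d) ∈ J := by
    rw [key]
    exact J.add_mem (J.mul_mem_left _ hRJ) (J.mul_mem_left _ hG)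
  exact mul_ne_zero (nonZeroDivisors.ne_zero hcm) (nonZeroDivisors.ne_zero hdm) (hC _ hmem)

theorem exists_eq_span_irreducible_of_rename_eq_zero {σ K : Type*} [Field K]
    (J : Ideal (MvPolynomial σ K)) [J.IsPrime] (hne : J ≠ ⊥) (v : σ)
    (hv : ∀ b : MvPolynomial {c // c ≠ v} K, rename Subtype.val b ∈ J → b = 0) :
    ∃ R, Irreducible R ∧ J = Ideal.span {R} := by
  classical
  let e : MvPolynomial σ K ≃ₐ[K] Polynomial (MvPolynomial {c // c ≠ v} K) :=
    (renameEquiv K (Equiv.optionSubtypeNe v).symm).trans (optionEquivLeft K _)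
  have hsymm : ∀ b, e.symm (Polynomial.C b) = rename Subtype.val b := by
    intro b
    rw [AlgEquiv.symm_apply_eq]
    simp only [e, AlgEquiv.trans_apply, renameEquiv_apply, rename_rename]
    have : ((Equiv.optionSubtypeNe v).symm ∘ Subtype.val : {c // c ≠ v} → _) = some := by
      ext x : 1
      simpa using x.2
    rw [this, optionEquivLeft_apply]
    induction b using MvPolynomial.induction_on with
    | C c => simp
    | add p q hp hq => simp only [map_add, hp, hq]
    | mul_X p i hp => simp only [map_mul, ← hp]; simp
  have hp : (J.comap e.symm).IsPrime := Ideal.comap_isPrime _ _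
  obtain ⟨R, hR, hJ⟩ := exists_eq_span_irreducible_of_comap_C_eq_bot (J.comap e.symm)
    (by
      obtain ⟨x, hx, hx0⟩ := Submodule.exists_mem_ne_zero_of_ne_bot hne
      intro h
      have : e x ∈ J.comap e.symm := by simpa [Ideal.mem_comap] using hx
      rw [h, Ideal.mem_bot] at this
      exact hx0 (by simpa using this))
    (fun b hb => hv b (by rw [← hsymm]; exact hb))
  refine ⟨e.symm R, (MulEquiv.irreducible_iff e.symm).2 hR, ?_⟩
  ext x
  have : x ∈ J ↔ e x ∈ J.comap e.symm := by simp [Ideal.mem_comap]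
  rw [this, hJ, Ideal.mem_span_singleton, Ideal.mem_span_singleton]
  conv_rhs => rw [← map_dvd_iff e]
  simp

end Algebra

/-! ### Systems of forms and determinants that vanish at solvable systems. -/

section Systems

instance {n : ℕ} (t : ℕ) : Finite {α : Fin n →₀ ℕ // α.degree = t} :=
  Finsupp.finite_of_degree_eq t

noncomputable instance {n : ℕ} (t : ℕ) : Fintype {α : Fin n →₀ ℕ // α.degree = t} :=
  Fintype.ofFinite _

theorem sum_monomial_coeff {n : ℕ} {K : Type*} [CommSemiring K] {p : MvPolynomial (Fin n) K}
    {t : ℕ} (hp : p.IsHomogeneous t) :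
    ∑ α : {α : Fin n →₀ ℕ // α.degree = t}, monomial α.1 (coeff α.1 p) = p := by
  classical
  ext β
  simp only [coeff_sum, coeff_monomial]
  by_cases hβ : β.degree = t
  · rw [Finset.sum_eq_single ⟨β, hβ⟩ (fun b _ hb => if_neg fun h => hb (Subtype.ext h))
      (fun h => absurd (Finset.mem_univ _) h)]
    simp
  · rw [hp.coeff_eq_zero hβ]
    exact Finset.sum_eq_zero fun b _ => if_neg fun h : b.1 = β => hβ (h ▸ b.2)

theorem homogeneousComponent_mul_of_isHomogeneous {σ K : Type*} [CommSemiring K]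
    {p h : MvPolynomial σ K} {s : ℕ} (hh : h.IsHomogeneous s) (m : ℕ) :
    homogeneousComponent (m + s) (p * h) = homogeneousComponent m p * h := by
  let _ := gradedAlgebra (σ := σ) (R := K)
  have := DirectSum.coe_decompose_mul_add_of_right_mem (homogeneousSubmodule σ K) (a := p) (b := h)
    (i := m) (j := s) hh
  exact (decomposition.decompose'_apply _ _).symm.trans
    (this.trans (congrArg (· * h) (decomposition.decompose'_apply _ _)))

variable {n : ℕ} {K : Type*} [CommRing K]

/-- The `i`-th form of the system with coefficients `u`. -/
noncomputable def form (r : Fin n → ℕ) (u : CoeffIndex r → K) (i : Fin n) :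
    MvPolynomial (Fin n) K :=
  ∑ α : {α : Fin n →₀ ℕ // α.degree = r i}, monomial α.1 (u ⟨i, α⟩)

theorem form_isHomogeneous (r : Fin n → ℕ) (u : CoeffIndex r → K) (i : Fin n) :
    (form r u i).IsHomogeneous (r i) :=
  IsHomogeneous.sum _ _ _ fun α _ => isHomogeneous_monomial _ α.2

theorem coeff_form (r : Fin n → ℕ) (u : CoeffIndex r → K) (c : CoeffIndex r) :
    coeff c.2.1 (form r u c.1) = u c := by
  classical
  obtain ⟨i, α⟩ := c
  simp only [form, coeff_sum, coeff_monomial]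
  rw [Finset.sum_eq_single α (fun b _ hb => if_neg fun h => hb (Subtype.ext h))
      (fun h => absurd (Finset.mem_univ _) h)]
  simp

@[simp]
theorem systemCoeffs_form (r : Fin n → ℕ) (u : CoeffIndex r → ℂ) :
    systemCoeffs r (form r u) = u :=
  funext fun c => coeff_form r u c

theorem form_eq_of_coeff {r : Fin n → ℕ} {u : CoeffIndex r → K} {i : Fin n}
    {h : MvPolynomial (Fin n) K} (hh : h.IsHomogeneous (r i))
    (hu : ∀ α : {α : Fin n →₀ ℕ // α.degree = r i}, u ⟨i, α⟩ = coeff α.1 h) :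
    form r u i = h := by
  rw [← sum_monomial_coeff hh, form]
  simp only [hu]

theorem form_systemCoeffs {r : Fin n → ℕ} {h : Fin n → MvPolynomial (Fin n) ℂ} {i : Fin n}
    (hh : (h i).IsHomogeneous (r i)) : form r (systemCoeffs r h) i = h i :=
  form_eq_of_coeff hh fun _ => rfl

/-- The system with coefficients `u` has a nontrivial zero. -/
def HasZero (r : Fin n → ℕ) (u : CoeffIndex r → ℂ) : Prop :=
  ∃ x : Fin n → ℂ, x ≠ 0 ∧ ∀ i, eval x (form r u i) = 0

theorem hasZero_systemCoeffs {r : Fin n → ℕ} {h : Fin n → MvPolynomial (Fin n) ℂ}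
    (hh : ∀ i, (h i).IsHomogeneous (r i)) :
    HasZero r (systemCoeffs r h) ↔ ∃ x : Fin n → ℂ, x ≠ 0 ∧ ∀ i, eval x (h i) = 0 := by
  simp only [HasZero, form_systemCoeffs (hh _)]

theorem IsResultant.eval_eq_zero_iff_hasZero {r : Fin n → ℕ} {R : MvPolynomial (CoeffIndex r) ℂ}
    (hR : IsResultant r R) (u : CoeffIndex r → ℂ) : eval u R = 0 ↔ HasZero r u := by
  have := hR.eval_eq_zero_iff (form r u) (form_isHomogeneous r u)
  rwa [systemCoeffs_form] at this

/-- The coefficients of the system `s₁ x₁ ^ r₁, …, sₙ xₙ ^ rₙ`. -/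
noncomputable def powCoeffs (r : Fin n → ℕ) (s : Fin n → ℂ) : CoeffIndex r → ℂ :=
  systemCoeffs r fun i => C (s i) * X i ^ r i

theorem form_powCoeffs (r : Fin n → ℕ) (s : Fin n → ℂ) (i : Fin n) :
    form r (powCoeffs r s) i = C (s i) * X i ^ r i :=
  form_systemCoeffs (isHomogeneous_C_mul_X_pow _ _ _)

theorem powCoeffs_one (r : Fin n → ℕ) :
    powCoeffs r 1 = systemCoeffs r fun i => X i ^ r i := by
  simp [powCoeffs]

theorem hasZero_powCoeffs {r : Fin n → ℕ} (hr : ∀ i, r i ≠ 0) {s : Fin n → ℂ} :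
    HasZero r (powCoeffs r s) ↔ ∃ i, s i = 0 := by
  simp only [HasZero, form_powCoeffs, map_mul, eval_C, map_pow, eval_X, mul_eq_zero,
    pow_eq_zero_iff (hr _)]
  constructor
  · rintro ⟨x, hx, h⟩
    by_contra! hs
    exact hx (funext fun i => (h i).resolve_left (hs i))
  · rintro ⟨i, hi⟩
    refine ⟨Pi.single i 1, by simp, fun j => ?_⟩
    by_cases hj : j = i
    · exact Or.inl (hj ▸ hi)
    · exact Or.inr (by simp [hj])

/-- The determinant of the linear map `x ^ α ↦ ∑ i, q α i * hᵢ` on forms of degree `t`, as a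
polynomial in the coefficients of the system `h`. -/
noncomputable def minorPoly (r : Fin n → ℕ) (t : ℕ)
    (q : {α : Fin n →₀ ℕ // α.degree = t} → Fin n → MvPolynomial (Fin n) ℂ) :
    MvPolynomial (CoeffIndex r) ℂ := by
  classical
  exact Matrix.det (Matrix.of fun α α' : {α : Fin n →₀ ℕ // α.degree = t} =>
    ∑ c : CoeffIndex r, C (coeff α'.1 (q α c.1 * monomial c.2.1 1)) * X c)

open Classical in
theorem eval_minorPoly (r : Fin n → ℕ) (t : ℕ)
    (q : {α : Fin n →₀ ℕ // α.degree = t} → Fin n → MvPolynomial (Fin n) ℂ)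
    (u : CoeffIndex r → ℂ) :
    eval u (minorPoly r t q) = Matrix.det (Matrix.of
      fun α α' : {α : Fin n →₀ ℕ // α.degree = t} => coeff α'.1 (∑ i, q α i * form r u i)) := by
  rw [minorPoly, RingHom.map_det]
  congr 1
  ext α α'
  simp only [RingHom.mapMatrix_apply, Matrix.map_apply, Matrix.of_apply, map_sum, map_mul, eval_C,
    eval_X, Fintype.sum_sigma, form, coeff_sum, Finset.mul_sum]
  refine Finset.sum_congr rfl fun i _ => Finset.sum_congr rfl fun β _ => ?_
  have : monomial β.1 (u ⟨i, β⟩) = C (u ⟨i, β⟩) * monomial β.1 (1 : ℂ) := by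
    rw [C_mul_monomial, mul_one]
  rw [this, mul_left_comm, coeff_C_mul, mul_comm]

/-- The values of the monomials of degree `t` at a common zero form a nonzero kernel vector, since
each row is a combination of the forms. -/
theorem eval_minorPoly_eq_zero {r : Fin n → ℕ} {t : ℕ} (hrt : ∀ i, r i ≤ t)
    {q : {α : Fin n →₀ ℕ // α.degree = t} → Fin n → MvPolynomial (Fin n) ℂ}
    (hq : ∀ α i, (q α i).IsHomogeneous (t - r i)) {u : CoeffIndex r → ℂ} (hu : HasZero r u) :
    eval u (minorPoly r t q) = 0 := by
  classical
  obtain ⟨x, hx, hxu⟩ := hu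
  rw [eval_minorPoly, ← Matrix.exists_mulVec_eq_zero_iff]
  refine ⟨fun α => eval x (monomial α.1 1), ?_, ?_⟩
  · obtain ⟨i, hi⟩ := Function.ne_iff.1 hx
    refine Function.ne_iff.2 ⟨⟨Finsupp.single i t, by simp⟩, ?_⟩
    simpa [eval_monomial] using pow_ne_zero t hi
  · ext α
    have hhom : (∑ i, q α i * form r u i).IsHomogeneous t :=
      IsHomogeneous.sum _ _ _ fun i _ => by
        simpa [Nat.sub_add_cancel (hrt i)] using (hq α i).mul (form_isHomogeneous r u i)
    have h := congrArg (eval x) (sum_monomial_coeff hhom)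
    simp only [map_sum, map_mul, hxu, mul_zero, Finset.sum_const_zero] at h
    simpa [Matrix.mulVec, dotProduct, eval_monomial] using h

theorem eval_minorPoly_eq_one {r : Fin n → ℕ} {t : ℕ}
    {q : {α : Fin n →₀ ℕ // α.degree = t} → Fin n → MvPolynomial (Fin n) ℂ}
    {u : CoeffIndex r → ℂ} (h : ∀ α, ∑ i, q α i * form r u i = monomial α.1 1) :
    eval u (minorPoly r t q) = 1 := by
  classical
  rw [eval_minorPoly, ← Matrix.det_one (n := {α : Fin n →₀ ℕ // α.degree = t})]
  congr 1
  ext α α'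
  simp [h, coeff_monomial, Matrix.one_apply, Subtype.ext_iff]

/-- By the Nullstellensatz every monomial of large degree lies in the ideal of the forms;
homogeneous cofactors then make the matrix the identity. -/
theorem exists_minorPoly_eval_eq_one {r : Fin n → ℕ} (hn : n ≠ 0) {u : CoeffIndex r → ℂ}
    (hu : ¬ HasZero r u) : ∃ t, (∀ i, r i ≤ t) ∧
      ∃ q : {α : Fin n →₀ ℕ // α.degree = t} → Fin n → MvPolynomial (Fin n) ℂ,
        (∀ α i, (q α i).IsHomogeneous (t - r i)) ∧ eval u (minorPoly r t q) = 1 := by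
  classical
  set I := Ideal.span (Set.range (form r u)) with hI
  have hX : ∀ j, ∃ s, (X j : MvPolynomial (Fin n) ℂ) ^ s ∈ I := by
    intro j
    have : X j ∈ vanishingIdeal ℂ (zeroLocus ℂ I) := by
      intro x hx
      have hx0 : x = 0 := by
        by_contra hne
        refine hu ⟨x, hne, fun i => ?_⟩
        have := hx _ (Ideal.subset_span (Set.mem_range_self i))
        rwa [MvPolynomial.aeval_eq_eval] at this
      simp [hx0]
    rw [vanishingIdeal_zeroLocus_eq_radical] at this
    exact this
  choose s hs using hX
  have hn' : (Finset.univ : Finset (Fin n)).Nonempty :=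
    Finset.univ_nonempty_iff.2 ⟨⟨0, Nat.pos_of_ne_zero hn⟩⟩
  -- The summands `s i` force some exponent `≥ s j` by pigeonhole; the summands `r i` ensure `r i ≤
  -- t`.
  refine ⟨∑ i, (s i + r i), fun i => (Nat.le_add_left _ _).trans
    (Finset.single_le_sum (f := fun i => s i + r i) (fun _ _ => Nat.zero_le _)
      (Finset.mem_univ i)), ?_⟩
  set t := ∑ i, (s i + r i) with ht
  have hrt : ∀ i, r i ≤ t := fun i => (Nat.le_add_left _ _).trans
    (Finset.single_le_sum (f := fun i => s i + r i) (fun _ _ => Nat.zero_le _)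
      (Finset.mem_univ i))
  have hmon : ∀ α : {α : Fin n →₀ ℕ // α.degree = t}, ∃ q : Fin n → MvPolynomial (Fin n) ℂ,
      (∀ i, (q i).IsHomogeneous (t - r i)) ∧ ∑ i, q i * form r u i = monomial α.1 1 := by
    intro α
    have hmem : monomial α.1 (1 : ℂ) ∈ I := by
      obtain ⟨j, -, hj⟩ := Finset.exists_le_of_sum_le hn' (f := s) (g := α.1) (by
        rw [← Finsupp.degree_eq_sum, α.2, ht]
        exact Finset.sum_le_sum fun i _ => Nat.le_add_right _ _)
      have : monomial α.1 (1 : ℂ) = monomial (α.1 - Finsupp.single j (s j)) 1 * X j ^ s j := by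
        rw [X_pow_eq_monomial, monomial_mul, mul_one,
          tsub_add_cancel_of_le (by simpa using hj)]
      rw [this]
      exact I.mul_mem_left _ (hs j)
    obtain ⟨c, hc⟩ := Ideal.mem_span_range_iff_exists_fun.1 hmem
    refine ⟨fun i => homogeneousComponent (t - r i) (c i),
      fun i => homogeneousComponent_isHomogeneous _ _, ?_⟩
    have := congrArg (homogeneousComponent t) hc
    rw [map_sum, homogeneousComponent_eq_self (isHomogeneous_monomial _ α.2)] at this
    rw [← this]
    refine Finset.sum_congr rfl fun i _ => ?_
    rw [← homogeneousComponent_mul_of_isHomogeneous (form_isHomogeneous r u i),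
      Nat.sub_add_cancel (hrt i)]
  choose q hq hqs using hmon
  exact ⟨q, hq, eval_minorPoly_eq_one hqs⟩

end Systems

/-! ### Existence and uniqueness of the resultant. -/

section Existence

theorem eval_aeval_mvPolynomial {σ τ K : Type*} [CommRing K] (p : τ → K)
    (φ : σ → MvPolynomial τ K) (F : MvPolynomial σ K) :
    eval p (aeval φ F) = eval (fun c => eval p (φ c)) F := by
  induction F using MvPolynomial.induction_on with
  | C c => simp
  | add p q hp hq => simp only [map_add, hp, hq]
  | mul_X p i hp => simp only [map_mul, hp]; simp

theorem eval_zero_of_isHomogeneous {σ K : Type*} [CommRing K] {p : MvPolynomial σ K} {t : ℕ}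
    (hp : p.IsHomogeneous t) (ht : t ≠ 0) : eval 0 p = 0 := by
  rw [eval_zero, constantCoeff_eq]
  exact hp.coeff_eq_zero (by simpa using ht.symm)

variable {n : ℕ}

/-- A polynomial parametrization of the systems with a nontrivial zero: it sends a system `g`, a
point `x` and a linear form `y` to the system `y(x) ^ rᵢ • gᵢ - gᵢ(x) • y ^ rᵢ`. -/
noncomputable def zeroParam (r : Fin n → ℕ) (c : CoeffIndex r) :
    MvPolynomial (CoeffIndex r ⊕ Fin n ⊕ Fin n) ℂ :=
  (∑ j, X (.inr (.inr j)) * X (.inr (.inl j))) ^ r c.1 * X (.inl c) -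
    (∑ α : {α : Fin n →₀ ℕ // α.degree = r c.1},
      X (.inl ⟨c.1, α⟩) * ∏ j, X (.inr (.inl j)) ^ α.1 j) *
    coeff c.2.1 ((∑ j, C (X (.inr (.inr j))) * X j) ^ r c.1)

theorem form_zeroParam (r : Fin n → ℕ) (p : CoeffIndex r ⊕ Fin n ⊕ Fin n → ℂ) (i : Fin n) :
    form r (fun c => eval p (zeroParam r c)) i =
      C ((∑ j, p (.inr (.inr j)) * p (.inr (.inl j))) ^ r i) * form r (fun c => p (.inl c)) i -
      C (eval (fun j => p (.inr (.inl j))) (form r (fun c => p (.inl c)) i)) *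
        (∑ j, C (p (.inr (.inr j))) * X j) ^ r i := by
  have hlin : (∑ j, C (p (.inr (.inr j))) * X j : MvPolynomial (Fin n) ℂ).IsHomogeneous 1 :=
    IsHomogeneous.sum _ _ _ fun j _ => isHomogeneous_C_mul_X _ _
  refine form_eq_of_coeff (((form_isHomogeneous r _ i).C_mul _).sub
    (IsHomogeneous.C_mul (by simpa using hlin.pow (r i)) _)) fun α => ?_
  have hform : coeff α.1 (form r (fun c => p (.inl c)) i) = p (.inl ⟨i, α⟩) :=
    coeff_form r (fun c => p (.inl c)) ⟨i, α⟩
  rw [coeff_sub, coeff_C_mul, coeff_C_mul, hform, zeroParam]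
  simp only [map_sub, map_mul, map_pow, map_sum, map_prod, eval_X, ← coeff_map, map_C, map_X, form,
    eval_monomial, Finsupp.prod_fintype _ _ (fun _ => pow_zero _)]

/-- Every parametrized system vanishes at its point `x`. Conversely, a system with zero `x` is its
own image once `y(x) = 1`. -/
theorem hasZero_iff_exists_zeroParam {r : Fin n → ℕ} (hn : n ≠ 0) (hr : ∀ i, r i ≠ 0)
    (u : CoeffIndex r → ℂ) : HasZero r u ↔ ∃ p, u = fun c => eval p (zeroParam r c) := by
  constructor
  · rintro ⟨x, hx, hxu⟩
    obtain ⟨i, hi⟩ := Function.ne_iff.1 hx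
    let p : CoeffIndex r ⊕ Fin n ⊕ Fin n → ℂ := Sum.elim u (Sum.elim x (Pi.single i (x i)⁻¹))
    refine ⟨p, ?_⟩
    rw [← systemCoeffs_form r u, ← systemCoeffs_form r (fun c => eval p (zeroParam r c))]
    congr 1
    ext1 j
    have h1 : ∑ j, p (.inr (.inr j)) * p (.inr (.inl j)) = 1 := by
      simp only [p, Sum.elim_inr, Sum.elim_inl]
      rw [Finset.sum_eq_single i (fun b _ hb => by simp [hb]) (by simp)]
      simpa using inv_mul_cancel₀ hi
    have h2 : (fun c => p (.inl c)) = u := rfl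
    have h3 : (fun j => p (.inr (.inl j))) = x := rfl
    rw [form_zeroParam, h1, h2, h3, hxu j]
    simp
  · rintro ⟨p, rfl⟩
    by_cases hx : (fun j => p (.inr (.inl j))) = 0
    -- For `x = 0` the parametrized system is identically zero, as all degrees are positive, so any
    -- nonzero vector is a zero.
    · have hx' : ∀ j, p (.inr (.inl j)) = 0 := fun j => congrFun hx j
      refine ⟨Pi.single ⟨0, Nat.pos_of_ne_zero hn⟩ 1, by simp, fun i => ?_⟩
      rw [form_zeroParam, hx, eval_zero_of_isHomogeneous (form_isHomogeneous r _ i) (hr i)]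
      simp [hx', zero_pow (hr i)]
    · refine ⟨_, hx, fun i => ?_⟩
      rw [form_zeroParam]
      simp only [map_sub, map_mul, map_pow, map_sum, eval_C, eval_X]
      ring

/-- The ideal of all polynomials that vanish at the systems with a nontrivial zero. -/
noncomputable def hasZeroIdeal (r : Fin n → ℕ) : Ideal (MvPolynomial (CoeffIndex r) ℂ) :=
  vanishingIdeal ℂ {u | HasZero r u}

theorem mem_hasZeroIdeal {r : Fin n → ℕ} {F : MvPolynomial (CoeffIndex r) ℂ} :
    F ∈ hasZeroIdeal r ↔ ∀ u, HasZero r u → eval u F = 0 := by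
  simp only [hasZeroIdeal, mem_vanishingIdeal_iff, MvPolynomial.aeval_eq_eval]
  rfl

theorem hasZeroIdeal_eq_ker {r : Fin n → ℕ} (hn : n ≠ 0) (hr : ∀ i, r i ≠ 0) :
    hasZeroIdeal r = RingHom.ker (aeval (R := ℂ) (zeroParam r)) := by
  ext F
  rw [mem_hasZeroIdeal, RingHom.mem_ker]
  constructor
  · intro h
    refine MvPolynomial.funext fun p => ?_
    rw [eval_aeval_mvPolynomial, map_zero]
    exact h _ ((hasZero_iff_exists_zeroParam hn hr _).2 ⟨p, rfl⟩)
  · intro h u hu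
    obtain ⟨p, rfl⟩ := (hasZero_iff_exists_zeroParam hn hr u).1 hu
    rw [← eval_aeval_mvPolynomial, h, map_zero]

theorem hasZeroIdeal_isPrime {r : Fin n → ℕ} (hn : n ≠ 0) (hr : ∀ i, r i ≠ 0) :
    (hasZeroIdeal r).IsPrime := by
  rw [hasZeroIdeal_eq_ker hn hr]
  exact RingHom.ker_isPrime _

/-- Macaulay's determinant, of degree at most `∏ j ≠ i, r j` in the coefficients of the `i`-th
form. -/
theorem exists_macaulay {r : Fin n → ℕ} (i : Fin n) :
    ∃ M ∈ hasZeroIdeal r, ∃ N ≤ ∏ j : {j // j ≠ i}, r j,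
      ∀ s, eval (powCoeffs r (Function.update 1 i s)) M = s ^ N := by
  classical
  set t := ∑ j, r j with ht
  have hrt : ∀ j, r j ≤ t := fun j =>
    Finset.single_le_sum (f := r) (fun _ _ => Nat.zero_le _) (Finset.mem_univ j)
  -- Index `i` is chosen only when no other index is possible. The `α` with `c α = i` are then
  -- determined by exponents below `r j` for `j ≠ i`, which gives the bound on `N`.
  have hc : ∀ α : {α : Fin n →₀ ℕ // α.degree = t}, ∃ c, r c ≤ α.1 c ∧
      (c = i → ∀ j, j ≠ i → α.1 j < r j) := by
    intro α
    by_cases h : ∃ j, j ≠ i ∧ r j ≤ α.1 j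
    · obtain ⟨j, hj, hjα⟩ := h
      exact ⟨j, hjα, fun h => absurd h hj⟩
    · push Not at h
      obtain ⟨j, -, hj⟩ := Finset.exists_le_of_sum_le ⟨i, Finset.mem_univ i⟩ (f := r) (g := α.1)
        (by rw [← Finsupp.degree_eq_sum, α.2])
      have : j = i := by
        by_contra hne
        exact absurd hj (not_le.2 (h j hne))
      exact ⟨i, this ▸ hj, fun _ => h⟩
  choose c hc hci using hc
  let q : {α : Fin n →₀ ℕ // α.degree = t} → Fin n → MvPolynomial (Fin n) ℂ := fun α j =>
    if j = c α then monomial (α.1 - Finsupp.single (c α) (r (c α))) 1 else 0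
  have hq : ∀ α j, (q α j).IsHomogeneous (t - r j) := by
    intro α j
    simp only [q]
    split_ifs with h
    · subst h
      refine isHomogeneous_monomial _ ?_
      have h1 : (α.1 - Finsupp.single (c α) (r (c α))) + Finsupp.single (c α) (r (c α)) = α.1 :=
        tsub_add_cancel_of_le (by simpa using hc α)
      have h2 := congrArg Finsupp.degree h1
      rw [map_add, α.2, Finsupp.degree_single] at h2
      omega
    · exact isHomogeneous_zero _ _ _
  refine ⟨minorPoly r t q, mem_hasZeroIdeal.2 fun u hu => eval_minorPoly_eq_zero hrt hq hu,
    (Finset.univ.filter fun α => c α = i).card, ?_, fun s => ?_⟩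
  · have := Finset.card_le_card_of_injOn (s := Finset.univ.filter fun α => c α = i)
      (t := Fintype.piFinset fun j : {j // j ≠ i} => Finset.range (r j))
      (fun α j => α.1 j) (by
        intro α hα
        simp only [Finset.coe_filter, Finset.mem_univ, true_and, Set.mem_ofPred_eq] at hα
        simpa using fun j hj => hci α hα j hj) (by
        intro α _ β _ hαβ
        have h1 : ∀ j, j ≠ i → α.1 j = β.1 j := fun j hj => congrFun hαβ ⟨j, hj⟩
        have h2 : α.1.degree = β.1.degree := α.2.trans β.2.symm
        rw [Finsupp.degree_eq_sum, Finsupp.degree_eq_sum,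
          ← Finset.add_sum_erase _ _ (Finset.mem_univ i),
          ← Finset.add_sum_erase _ _ (Finset.mem_univ i),
          Finset.sum_congr rfl fun j hj => h1 j (Finset.ne_of_mem_erase hj)] at h2
        refine Subtype.ext (Finsupp.ext fun j => ?_)
        by_cases hj : j = i
        · subst hj
          exact Nat.add_right_cancel h2
        · exact h1 j hj)
    simpa [Fintype.card_piFinset] using this
  -- At this system the matrix is diagonal, with entry `s` where `c α = i` and `1` elsewhere.
  · rw [eval_minorPoly]
    have hsum : ∀ α, ∑ j, q α j * form r (powCoeffs r (Function.update 1 i s)) j =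
        monomial α.1 (Function.update (1 : Fin n → ℂ) i s (c α)) := by
      intro α
      rw [Finset.sum_eq_single (c α) (fun j _ hj => by simp [q, hj]) (by simp), form_powCoeffs]
      simp only [q, if_pos]
      rw [mul_left_comm, X_pow_eq_monomial, monomial_mul, C_mul_monomial,
        tsub_add_cancel_of_le (by simpa using hc α)]
      simp
    simp only [hsum, coeff_monomial]
    have hdiag : (Matrix.of fun α α' : {α : Fin n →₀ ℕ // α.degree = t} =>
        if α.1 = α'.1 then Function.update (1 : Fin n → ℂ) i s (c α) else 0) =
        Matrix.diagonal fun α => Function.update (1 : Fin n → ℂ) i s (c α) := by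
      ext α α'
      simp [Matrix.diagonal_apply, Subtype.ext_iff]
    rw [hdiag, Matrix.det_diagonal]
    simp only [Function.update_apply, Pi.one_apply]
    rw [Finset.prod_ite]
    simp

theorem hasZeroIdeal_ne_bot {r : Fin n → ℕ} (hn : n ≠ 0) : hasZeroIdeal r ≠ ⊥ := by
  obtain ⟨M, hM, N, -, hs⟩ := exists_macaulay (r := r) ⟨0, Nat.pos_of_ne_zero hn⟩
  intro h
  rw [h, Ideal.mem_bot] at hM
  simpa [hM] using hs 1

/-- The other `n - 1` forms always have a common nontrivial zero `x`. If `x i ≠ 0`, changing only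
the coefficient of `xᵢ ^ rᵢ` makes `x` a zero of the whole system. As `b` does not involve that
coefficient, it vanishes at all such systems, hence on a dense set. -/
theorem eq_zero_of_rename_mem_hasZeroIdeal {r : Fin n → ℕ} (hr : ∀ i, r i ≠ 0) (i : Fin n)
    (b : MvPolynomial {c : CoeffIndex r // c ≠ ⟨i, Finsupp.single i (r i), by simp⟩} ℂ)
    (hb : rename Subtype.val b ∈ hasZeroIdeal r) : b = 0 := by
  classical
  obtain ⟨M, hM, N, -, hs⟩ := exists_macaulay (r := r) i
  -- Replaces the `i`-th form by `xᵢ ^ rᵢ`: where `aeval φ M` is nonzero, no nontrivial zero of the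
  -- other forms has `x i = 0`.
  let φ : CoeffIndex r → MvPolynomial (CoeffIndex r) ℂ := fun c =>
    if c.1 = i then C (coeff c.2.1 (X i ^ r i)) else X c
  have hφ : ∀ u, eval u (aeval φ M) =
      eval (systemCoeffs r fun j => if j = i then X i ^ r i else form r u j) M := by
    intro u
    rw [eval_aeval_mvPolynomial]
    congr 2
    ext c
    simp only [φ, systemCoeffs]
    split_ifs
    · simp
    · simp [coeff_form]
  have hhom : ∀ (u : CoeffIndex r → ℂ) j,
      (if j = i then X i ^ r i else form r u j).IsHomogeneous (r j) := by
    intro u j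
    split_ifs with h
    · exact h ▸ isHomogeneous_X_pow _ _
    · exact form_isHomogeneous r u j
  have hφ0 : aeval φ M ≠ 0 := by
    intro h
    have h1 := hφ (powCoeffs r 1)
    have h2 : (fun j => if j = i then X i ^ r i else form r (powCoeffs r 1) j) =
        fun j => (X j ^ r j : MvPolynomial (Fin n) ℂ) := by
      ext1 j
      split_ifs with h
      · rw [h]
      · simp [form_powCoeffs]
    have h3 := hs 1
    rw [h2, ← powCoeffs_one, h, map_zero] at h1
    rw [show (1 : ℂ) = (1 : Fin n → ℂ) i from rfl, Function.update_eq_self, ← h1] at h3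
    simp at h3
  have hprod : rename Subtype.val b * aeval φ M = 0 := by
    refine MvPolynomial.funext fun u => ?_
    rw [map_mul, map_zero, mul_eq_zero, or_iff_not_imp_right]
    intro hu
    have hfin : (form r u '' {j | j ≠ i}).Finite := Set.toFinite _
    obtain ⟨x, hx, hxu⟩ := exists_ne_zero_forall_eval_eq_zero hfin
      (lt_of_le_of_lt (Set.ncard_image_le (Set.toFinite _)) (by
        rw [← Set.ncard_univ]
        exact Set.ncard_lt_ncard (Set.ssubset_univ_iff.2 fun h => by
          have : i ∈ {j | j ≠ i} := h ▸ Set.mem_univ i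
          exact this rfl) (Set.toFinite _)))
      (by
        rintro _ ⟨j, -, rfl⟩
        exact eval_zero_of_isHomogeneous (form_isHomogeneous r u j) (hr j))
    have hxi : x i ≠ 0 := by
      intro h0
      rw [hφ] at hu
      refine hu (mem_hasZeroIdeal.1 hM _ ((hasZero_systemCoeffs (hhom u)).2 ⟨x, hx, fun j => ?_⟩))
      split_ifs with hj
      · simp [h0, hr i]
      · exact hxu _ ⟨j, hj, rfl⟩
    set a := eval x (form r u i) / x i ^ r i with ha
    let h : Fin n → MvPolynomial (Fin n) ℂ := fun j =>
      form r u j - if j = i then C a * X i ^ r i else 0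
    have hh : ∀ j, (h j).IsHomogeneous (r j) := by
      intro j
      refine (form_isHomogeneous r u j).sub ?_
      split_ifs with hj
      · exact hj ▸ isHomogeneous_C_mul_X_pow _ _ _
      · exact isHomogeneous_zero _ _ _
    have hz : HasZero r (systemCoeffs r h) := by
      refine (hasZero_systemCoeffs hh).2 ⟨x, hx, fun j => ?_⟩
      simp only [h]
      split_ifs with hj
      · subst hj
        simp only [map_sub, map_mul, eval_C, map_pow, eval_X, ha]
        rw [div_mul_cancel₀ _ (pow_ne_zero _ hxi), sub_self]
      · rw [sub_zero]
        exact hxu _ ⟨j, hj, rfl⟩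
    have h0 := mem_hasZeroIdeal.1 hb _ hz
    rw [eval_rename] at h0 ⊢
    refine Eq.trans (congrArg (fun w => eval w b) ?_) h0
    ext ⟨⟨j, α⟩, hc⟩
    have hcf : coeff α.1 (form r u j) = u ⟨j, α⟩ := coeff_form r u ⟨j, α⟩
    simp only [Function.comp_apply, systemCoeffs, h, coeff_sub, hcf]
    split_ifs with hj
    · subst hj
      rw [coeff_C_mul, coeff_X_pow, if_neg, mul_zero, sub_zero]
      intro hα
      exact hc (by congr 1; exact Subtype.ext hα.symm)
    · simp
  have := (mul_eq_zero.1 hprod).resolve_right hφ0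
  exact rename_injective _ Subtype.val_injective (by simpa using this)

/-- The generator is nonzero at an unsolvable system because it divides a determinant with value `1`
there. In particular it can be normalized at the system of powers. -/
theorem exists_isResultant {r : Fin n → ℕ} (hn : n ≠ 0) (hr : ∀ i, r i ≠ 0) :
    ∃ R, IsResultant r R := by
  have := hasZeroIdeal_isPrime hn hr
  obtain ⟨R, hR, hJ⟩ := exists_eq_span_irreducible_of_rename_eq_zero (hasZeroIdeal r)
    (hasZeroIdeal_ne_bot hn) _ (eq_zero_of_rename_mem_hasZeroIdeal hr ⟨0, Nat.pos_of_ne_zero hn⟩)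
  have hiff : ∀ u, eval u R = 0 ↔ HasZero r u := by
    intro u
    constructor
    · intro h0
      by_contra hu
      obtain ⟨t, hrt, q, hq, h1⟩ := exists_minorPoly_eval_eq_one hn hu
      have : minorPoly r t q ∈ hasZeroIdeal r :=
        mem_hasZeroIdeal.2 fun u hu => eval_minorPoly_eq_zero hrt hq hu
      rw [hJ, Ideal.mem_span_singleton] at this
      obtain ⟨F, hF⟩ := this
      rw [hF, map_mul, h0, zero_mul] at h1
      exact zero_ne_one h1
    · exact mem_hasZeroIdeal.1 (hJ ▸ Ideal.subset_span rfl) u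
  have h1 : eval (powCoeffs r 1) R ≠ 0 := by
    rw [Ne, hiff, hasZero_powCoeffs hr]
    simp
  have hunit : IsUnit (C (eval (powCoeffs r 1) R)⁻¹ : MvPolynomial (CoeffIndex r) ℂ) :=
    (isUnit_iff_ne_zero.2 (inv_ne_zero h1)).map C
  refine ⟨C (eval (powCoeffs r 1) R)⁻¹ * R, (irreducible_isUnit_mul hunit).2 hR, fun h hh => ?_, ?_⟩
  · rw [map_mul, eval_C, mul_eq_zero, or_iff_right (inv_ne_zero h1), hiff, hasZero_systemCoeffs hh]
  · rw [← powCoeffs_one, map_mul, eval_C, inv_mul_cancel₀ h1]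

theorem IsResultant.prime {r : Fin n → ℕ} {R : MvPolynomial (CoeffIndex r) ℂ}
    (hR : IsResultant r R) : Prime R :=
  UniqueFactorizationMonoid.irreducible_iff_prime.1 hR.irreducible

theorem IsResultant.dvd_of_mem {r : Fin n → ℕ} {R F : MvPolynomial (CoeffIndex r) ℂ}
    (hR : IsResultant r R) (hF : F ∈ hasZeroIdeal r) : R ∣ F := by
  obtain ⟨N, hN⟩ := dvd_pow_of_eval_eq_zero_imp (F := R) (G := F) fun u hu =>
    mem_hasZeroIdeal.1 hF u ((hR.eval_eq_zero_iff_hasZero u).1 hu)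
  exact hR.prime.dvd_of_dvd_pow hN

theorem IsResultant.mem_hasZeroIdeal {r : Fin n → ℕ} {R : MvPolynomial (CoeffIndex r) ℂ}
    (hR : IsResultant r R) : R ∈ hasZeroIdeal r :=
  EDeterminant.mem_hasZeroIdeal.2 fun u hu => (hR.eval_eq_zero_iff_hasZero u).2 hu

/-- An irreducible polynomial that vanishes at all systems with a nontrivial zero is the resultant
up to its value at the system of powers. -/
theorem IsResultant.eq_C_mul {r : Fin n → ℕ} {R F : MvPolynomial (CoeffIndex r) ℂ}
    (hR : IsResultant r R) (hF : F ∈ hasZeroIdeal r) (hirr : Irreducible F) :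
    F = C (eval (powCoeffs r 1) F) * R := by
  obtain ⟨w, hw, hwF⟩ := (hR.irreducible.associated_of_dvd hirr (hR.dvd_of_mem hF))
  obtain ⟨c, hc, hcw⟩ := MvPolynomial.isUnit_iff_eq_C_of_isReduced.1 w.isUnit
  have h1 := hR.normalized
  rw [← powCoeffs_one] at h1
  rw [map_mul, h1, hcw, eval_C, one_mul, mul_comm]

theorem IsResultant.unique {r : Fin n → ℕ} {R R' : MvPolynomial (CoeffIndex r) ℂ}
    (hR : IsResultant r R) (hR' : IsResultant r R') : R = R' := by
  rw [hR'.eq_C_mul hR.mem_hasZeroIdeal hR.irreducible, powCoeffs_one, hR.normalized, C_1, one_mul]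

theorem existsUnique_isResultant {r : Fin n → ℕ} (hn : n ≠ 0) (hr : ∀ i, r i ≠ 0) :
    ∃! R, IsResultant r R := by
  obtain ⟨R, hR⟩ := exists_isResultant hn hr
  exact ⟨R, hR, fun R' hR' => hR'.unique hR⟩

theorem isResultant_resultantPoly {r : Fin n → ℕ} (hn : n ≠ 0) (hr : ∀ i, r i ≠ 0) :
    IsResultant r (resultantPoly r) := by
  have h := exists_isResultant hn hr
  rw [resultantPoly, dif_pos h]
  exact h.choose_spec

end Existence

/-! ### The degree of the resultant in each form. -/

section Degree

/-- The restriction of a polynomial to the affine line `s ↦ a + s • b`. -/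
noncomputable def restrictLine {σ K : Type*} [CommRing K] (a b : σ → K) :
    MvPolynomial σ K →ₐ[K] Polynomial K :=
  aeval fun c => Polynomial.C (a c) + Polynomial.C (b c) * Polynomial.X

theorem eval_restrictLine {σ K : Type*} [CommRing K] (a b : σ → K) (F : MvPolynomial σ K) (s : K) :
    (restrictLine a b F).eval s = eval (fun c => a c + b c * s) F := by
  rw [restrictLine]
  induction F using MvPolynomial.induction_on with
  | C c => simp
  | add p q hp hq => simp only [map_add, Polynomial.eval_add, hp, hq]
  | mul_X p i hp => simp only [map_mul, Polynomial.eval_mul, hp]; simp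

/-- Multiplying by `X ^ q.natDegree` turns `q(1/v)` into the reversed polynomial without negative
exponents. -/
theorem mul_X_pow_eq_of_eval_eq_pow_mul {K : Type*} [Field K] [Infinite K] {p q : Polynomial K}
    {e : ℕ} (h : ∀ v, v ≠ 0 → p.eval v = v ^ e * q.eval v⁻¹) :
    p * Polynomial.X ^ q.natDegree = Polynomial.X ^ e * q.reverse := by
  refine Polynomial.eq_of_infinite_eval_eq _ _ ((Set.infinite_univ (α := K)).sdiff
    (Set.finite_singleton (0 : K)) |>.mono fun v hv => ?_)
  have hv0 : v ≠ 0 := by simpa using hv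
  let _ := invertibleOfNonzero (inv_ne_zero hv0)
  have hrev := Polynomial.eval₂_reverse_mul_pow (RingHom.id K) v⁻¹ q
  simp only [invOf_eq_inv, inv_inv, Polynomial.eval₂_id] at hrev
  have : q.eval v⁻¹ * v ^ q.natDegree = q.reverse.eval v := by
    rw [← hrev, mul_assoc, ← mul_pow, inv_mul_cancel₀ hv0, one_pow, mul_one]
  change (p * Polynomial.X ^ q.natDegree).eval v = (Polynomial.X ^ e * q.reverse).eval v
  simp only [Polynomial.eval_mul, Polynomial.eval_pow, Polynomial.eval_X, h v hv0, ← this]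
  ring

theorem natDegree_le_of_eval_eq_pow_mul {K : Type*} [Field K] [Infinite K] {p q : Polynomial K}
    {e : ℕ} (h : ∀ v, v ≠ 0 → p.eval v = v ^ e * q.eval v⁻¹) : p.natDegree ≤ e := by
  by_cases hp : p = 0
  · simp [hp]
  have := congrArg Polynomial.natDegree (mul_X_pow_eq_of_eval_eq_pow_mul h)
  rw [Polynomial.natDegree_mul_X_pow _ hp] at this
  have h2 : (Polynomial.X ^ e * q.reverse).natDegree ≤ e + q.natDegree :=
    Polynomial.natDegree_mul_le.trans
      (add_le_add (Polynomial.natDegree_X_pow_le e) (Polynomial.reverse_natDegree_le q))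
  omega

theorem ne_zero_of_eval_eq_pow_mul {K : Type*} [Field K] [Infinite K] {p q : Polynomial K}
    {e : ℕ} (h : ∀ v, v ≠ 0 → p.eval v = v ^ e * q.eval v⁻¹) (hq : q ≠ 0) : p ≠ 0 := by
  rintro rfl
  have := mul_X_pow_eq_of_eval_eq_pow_mul h
  rw [zero_mul, eq_comm, mul_eq_zero] at this
  rcases this with h | h
  · exact pow_ne_zero _ Polynomial.X_ne_zero h
  · exact hq (by simpa using h)

variable {n : ℕ} {r : Fin n → ℕ} {R : MvPolynomial (CoeffIndex r) ℂ}

/-- The coefficients of the system in which the `i`-th form is multiplied by `t`. -/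
def scaleForm (i : Fin n) (t : ℂ) (u : CoeffIndex r → ℂ) : CoeffIndex r → ℂ :=
  fun c => (if c.1 = i then t else 1) * u c

theorem form_scaleForm (i : Fin n) (t : ℂ) (u : CoeffIndex r → ℂ) (j : Fin n) :
    form r (scaleForm i t u) j = C (if j = i then t else 1) * form r u j := by
  refine form_eq_of_coeff ((form_isHomogeneous r u j).C_mul _) fun α => ?_
  rw [coeff_C_mul, coeff_form r u ⟨j, α⟩, scaleForm]

theorem HasZero.scaleForm {u : CoeffIndex r → ℂ} (hu : HasZero r u) (i : Fin n) (t : ℂ) :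
    HasZero r (scaleForm i t u) := by
  obtain ⟨x, hx, h⟩ := hu
  exact ⟨x, hx, fun j => by rw [form_scaleForm, map_mul, h j, mul_zero]⟩

theorem scaleForm_powCoeffs_one (i : Fin n) (t : ℂ) :
    scaleForm i t (powCoeffs r 1) = powCoeffs r (Function.update 1 i t) := by
  rw [← systemCoeffs_form r (scaleForm i t _)]
  refine congrArg (systemCoeffs r) (funext fun j => ?_)
  rw [form_scaleForm, form_powCoeffs]
  simp [Function.update_apply]

/-- Scaling a form by `t ≠ 0` is an automorphism preserving solvability, so it carries `R` to a
scalar multiple of itself; the scalar is read off at the system of powers. -/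
theorem IsResultant.eval_scaleForm (hR : IsResultant r R) (i : Fin n) {t : ℂ} (ht : t ≠ 0)
    (u : CoeffIndex r → ℂ) :
    eval (scaleForm i t u) R = eval (powCoeffs r (Function.update 1 i t)) R * eval u R := by
  let f (s : ℂ) : MvPolynomial (CoeffIndex r) ℂ →ₐ[ℂ] MvPolynomial (CoeffIndex r) ℂ :=
    aeval fun c => C (if c.1 = i then s else 1) * X c
  have hf : ∀ s s', s * s' = 1 → (f s).comp (f s') = AlgHom.id ℂ _ := by
    intro s s' hs
    refine MvPolynomial.algHom_ext fun c => ?_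
    simp only [f, AlgHom.comp_apply, aeval_X, map_mul, AlgHom.id_apply, algHom_C, algebraMap_eq]
    rw [← mul_assoc, ← C_mul]
    split_ifs
    · rw [mul_comm s', hs, C_1, one_mul]
    · rw [one_mul, C_1, one_mul]
  let e := AlgEquiv.ofAlgHom (f t) (f t⁻¹) (hf _ _ (mul_inv_cancel₀ ht))
    (hf _ _ (inv_mul_cancel₀ ht))
  have heval : ∀ w, eval w (e R) = eval (scaleForm i t w) R := by
    intro w
    change eval w (f t R) = _
    rw [eval_aeval_mvPolynomial]
    simp only [map_mul, eval_C, eval_X]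
    rfl
  have hmem : e R ∈ hasZeroIdeal r := EDeterminant.mem_hasZeroIdeal.2 fun w hw => by
    rw [heval, hR.eval_eq_zero_iff_hasZero]
    exact hw.scaleForm i t
  have := hR.eq_C_mul hmem ((MulEquiv.irreducible_iff e).2 hR.irreducible)
  rw [← heval, this, map_mul, eval_C, heval, scaleForm_powCoeffs_one]

/-- `R` divides Macaulay's determinant, which restricts to `X ^ N` on this line; a divisor of `X ^
N` is a monomial, and normalization makes it monic. -/
theorem IsResultant.exists_eval_powCoeffs_update (hR : IsResultant r R) (i : Fin n) :
    ∃ e ≤ ∏ j : {j // j ≠ i}, r j,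
      ∀ t, eval (powCoeffs r (Function.update 1 i t)) R = t ^ e := by
  obtain ⟨M, hM, N, hN, hs⟩ := exists_macaulay (r := r) i
  let a : CoeffIndex r → ℂ := fun c => if c.1 = i then 0 else powCoeffs r 1 c
  let b : CoeffIndex r → ℂ := fun c => if c.1 = i then powCoeffs r 1 c else 0
  have hab : ∀ s F, (restrictLine a b F).eval s =
      eval (powCoeffs r (Function.update 1 i s)) F := by
    intro s F
    rw [eval_restrictLine, ← scaleForm_powCoeffs_one]
    congr 2
    ext c
    simp only [a, b, scaleForm]
    split_ifs <;> ring
  have hMX : restrictLine a b M = Polynomial.X ^ N :=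
    Polynomial.funext fun s => by rw [hab, hs, Polynomial.eval_pow, Polynomial.eval_X]
  have hdvd := map_dvd (restrictLine a b) (hR.dvd_of_mem hM)
  rw [hMX, dvd_prime_pow Polynomial.prime_X] at hdvd
  obtain ⟨e, he, hass⟩ := hdvd
  obtain ⟨w, hw⟩ := hass.symm
  obtain ⟨c, hc, hcw⟩ := Polynomial.isUnit_iff.1 w.isUnit
  have h1 : ∀ t, eval (powCoeffs r (Function.update 1 i t)) R = t ^ e * c := by
    intro t
    rw [← hab, ← hw, ← hcw, Polynomial.eval_mul, Polynomial.eval_pow, Polynomial.eval_X,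
      Polynomial.eval_C]
  have h2 := h1 1
  rw [show (1 : ℂ) = (1 : Fin n → ℂ) i from rfl, Function.update_eq_self, powCoeffs_one,
    hR.normalized, Pi.one_apply, one_pow, one_mul] at h2
  exact ⟨e, he.trans hN, fun t => by rw [h1, ← h2, mul_one]⟩

/-- The system `xⱼ ^ d = xⱼ₊₁ xᵢ ^ (d - 1)` for `j ≠ i` (indices modulo `n`), whose `i`-th form is
`a xᵢ ^ d - b xᵢ₊₁ xᵢ ^ (d - 1)`. -/
noncomputable def cyclicSystem [NeZero n] (d : ℕ) (i : Fin n) (a b : ℂ) (j : Fin n) :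
    MvPolynomial (Fin n) ℂ :=
  if j = i then C a * X i ^ d - C b * (X (i + 1) * X i ^ (d - 1))
  else X j ^ d - X (j + 1) * X i ^ (d - 1)

theorem cyclicSystem_isHomogeneous [NeZero n] {d : ℕ} (hd : d ≠ 0) (i : Fin n) (a b : ℂ)
    (j : Fin n) : (cyclicSystem d i a b j).IsHomogeneous d := by
  have h : ∀ k : Fin n, (X k * X i ^ (d - 1) : MvPolynomial (Fin n) ℂ).IsHomogeneous d := by
    intro k
    have := (isHomogeneous_X ℂ k).mul (isHomogeneous_X_pow (R := ℂ) i (d - 1))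
    rwa [show 1 + (d - 1) = d by omega] at this
  rw [cyclicSystem]
  split_ifs
  · exact (isHomogeneous_C_mul_X_pow _ _ _).sub ((h _).C_mul _)
  · exact (isHomogeneous_X_pow _ _).sub (h _)

theorem hasZero_cyclicSystem [NeZero n] {d : ℕ} (hd : d ≠ 0) (i : Fin n) {v : ℂ}
    (hv : v ^ d ^ (n - 1) = 1) :
    HasZero (fun _ => d) (systemCoeffs (fun _ => d) (cyclicSystem d i v 1)) := by
  rw [hasZero_systemCoeffs (cyclicSystem_isHomogeneous hd i v 1)]
  -- Starting from `x (i + 1) = v`, each coordinate is the `d`-th power of the one before; the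
  -- condition on `v` closes the cycle with `x i = 1`.
  let x : Fin n → ℂ := fun j => v ^ d ^ (j - i - 1).val
  have hxi : x i = 1 := by
    obtain ⟨m, rfl⟩ := Nat.exists_eq_succ_of_ne_zero (NeZero.ne n)
    simp only [x, sub_self, zero_sub]
    rw [Fin.coe_neg_one]
    exact hv
  refine ⟨x, fun h => one_ne_zero (hxi.symm.trans (congrFun h i)), fun j => ?_⟩
  rw [cyclicSystem]
  split_ifs with hj
  · have : x (i + 1) = v := by simp [x]
    simp [hxi, this]
  · have : (j - i).val = (j - i - 1).val + 1 := by
      obtain ⟨m, rfl⟩ := Nat.exists_eq_succ_of_ne_zero (NeZero.ne n)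
      have h0 : j - i ≠ 0 := sub_ne_zero.2 hj
      generalize j - i = k at h0
      have : (k - 1).val = k.val - 1 := Fin.val_sub_one_of_ne_zero h0
      have : k.val ≠ 0 := fun h => h0 (Fin.ext h)
      omega
    have hx : x (j + 1) = x j ^ d := by
      simp only [x]
      rw [← pow_mul, ← pow_succ, ← this]
      congr 3
      abel
    simp [hxi, hx]

theorem not_hasZero_cyclicSystem [NeZero n] {d : ℕ} (hd : 2 ≤ d) (i : Fin n) :
    ¬ HasZero (fun _ => d) (systemCoeffs (fun _ => d) (cyclicSystem d i 1 0)) := by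
  rw [hasZero_systemCoeffs (cyclicSystem_isHomogeneous (by omega) i 1 0)]
  rintro ⟨x, hx, h⟩
  have hd0 : d ≠ 0 := by omega
  have hi : x i = 0 := by simpa [cyclicSystem, hd0] using h i
  refine hx (funext fun j => ?_)
  by_cases hj : j = i
  · rw [hj, hi, Pi.zero_apply]
  · have hd1 : d - 1 ≠ 0 := by omega
    simpa [cyclicSystem, hj, hi, hd0, hd1] using h j

/-- The resultant of `n` forms of degree `d` has degree `d ^ (n - 1)` in each of them. -/
theorem IsResultant.eval_powCoeffs_update {d : ℕ} (hd : d ≠ 0)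
    {R : MvPolynomial (CoeffIndex fun _ : Fin n => d) ℂ} (hR : IsResultant (fun _ => d) R)
    (i : Fin n) (t : ℂ) :
    eval (powCoeffs (fun _ => d) (Function.update 1 i t)) R = t ^ d ^ (n - 1) := by
  have : NeZero n := ⟨fun h => (Fin.cast h i).elim0⟩
  obtain ⟨e, he, h⟩ := hR.exists_eval_powCoeffs_update i
  have he' : e ≤ d ^ (n - 1) := by simpa using he
  suffices d ^ (n - 1) ≤ e by rw [h, le_antisymm he' this]
  -- For `d = 1` it suffices that `e ≠ 0`, which holds since replacing the `i`-th form by zero makes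
  -- the system solvable.
  rcases (Nat.one_le_iff_ne_zero.2 hd).eq_or_lt with rfl | hd2
  · rw [one_pow, Nat.one_le_iff_ne_zero]
    rintro rfl
    have h0 := h 0
    rw [pow_zero] at h0
    refine one_ne_zero (h0.symm.trans ((hR.eval_eq_zero_iff_hasZero _).2 ?_))
    exact (hasZero_powCoeffs fun _ => hd).2 ⟨i, by simp⟩
  let r : Fin n → ℕ := fun _ => d
  let p : Polynomial ℂ := restrictLine (systemCoeffs r (cyclicSystem d i 0 1))
    (fun c => if c.1 = i then coeff c.2.1 (X i ^ d) else 0) R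
  let q : Polynomial ℂ := restrictLine (systemCoeffs r (cyclicSystem d i 1 0))
    (fun c => if c.1 = i then - coeff c.2.1 (X (i + 1) * X i ^ (d - 1)) else 0) R
  have hp : ∀ v, p.eval v = eval (systemCoeffs r (cyclicSystem d i v 1)) R := by
    intro v
    simp only [p]
    rw [eval_restrictLine]
    congr 2
    ext c
    simp only [systemCoeffs, cyclicSystem]
    split_ifs
    · simp only [coeff_sub, coeff_C_mul]
      ring
    · ring
  have hq : ∀ v, q.eval v = eval (systemCoeffs r (cyclicSystem d i 1 v)) R := by
    intro v
    simp only [q]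
    rw [eval_restrictLine]
    congr 2
    ext c
    simp only [systemCoeffs, cyclicSystem]
    split_ifs
    · simp only [coeff_sub, coeff_C_mul]
      ring
    · ring
  -- Dividing the `i`-th form by `v` moves the parameter to its other coefficient, so `p` has degree
  -- at most `e`; all `d ^ (n - 1)`-th roots of unity are roots of `p`.
  have hpq : ∀ v, v ≠ 0 → p.eval v = v ^ e * q.eval v⁻¹ := by
    intro v hv
    rw [hp, hq, ← h, ← hR.eval_scaleForm i hv]
    congr 2
    ext c
    simp only [systemCoeffs, cyclicSystem, scaleForm]
    split_ifs
    · simp only [coeff_sub, coeff_C_mul]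
      field_simp
    · ring
  have hq0 : q ≠ 0 := by
    intro h0
    have := hq 0
    rw [h0, Polynomial.eval_zero, eq_comm, hR.eval_eq_zero_iff_hasZero] at this
    exact not_hasZero_cyclicSystem hd2 i this
  have hp0 := ne_zero_of_eval_eq_pow_mul hpq hq0
  have hN : d ^ (n - 1) ≠ 0 := pow_ne_zero _ hd
  rw [← (Complex.isPrimitiveRoot_exp _ hN).card_nthRootsFinset]
  refine le_trans (Polynomial.card_le_degree_of_subset_roots fun v hv => ?_)
    (natDegree_le_of_eval_eq_pow_mul hpq)
  rw [Polynomial.mem_roots hp0, Polynomial.IsRoot, hp, hR.eval_eq_zero_iff_hasZero]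
  refine hasZero_cyclicSystem hd i ?_
  exact (Polynomial.mem_nthRootsFinset (Nat.pos_of_ne_zero hN) 1).1 hv

end Degree

/-! ### Resultants of block triangular systems. -/

section Triangular

theorem prime_rename_of_injective {σ τ K : Type*} [CommRing K] {f : σ → τ}
    (hf : Function.Injective f) {p : MvPolynomial σ K} (hp : Prime p) : Prime (rename f p) := by
  have h : rename f p =
      rename Subtype.val (renameEquiv K (Equiv.ofInjective f hf) p) := by
    rw [renameEquiv_apply, rename_rename]
    rfl
  rw [h, prime_rename_iff]
  exact (MulEquiv.prime_iff (renameEquiv K (Equiv.ofInjective f hf))).2 hp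

variable {n k l d : ℕ}

/-- The coefficient indices of forms of degree `d` in fewer variables, as coefficient indices of
forms in all variables, along an embedding of the index sets. -/
noncomputable def coeffIndexMap (d : ℕ) (e : Fin k ↪ Fin n) (c : CoeffIndex fun _ : Fin k => d) :
    CoeffIndex fun _ : Fin n => d :=
  ⟨e c.1, c.2.1.mapDomain e, by rw [Finsupp.degree_mapDomain, c.2.2]⟩

theorem coeffIndexMap_injective (d : ℕ) (e : Fin k ↪ Fin n) :
    Function.Injective (coeffIndexMap d e) := by
  rintro ⟨i, α, hα⟩ ⟨j, β, hβ⟩ h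
  simp only [coeffIndexMap, Sigma.mk.injEq, EmbeddingLike.apply_eq_iff_eq] at h
  obtain ⟨rfl, h⟩ := h
  have := congrArg Subtype.val (eq_of_heq h)
  have h' : α = β := Finsupp.mapDomain_injective e.injective this
  subst h'
  rfl

theorem eval_form_coeffIndexMap (e : Fin k ↪ Fin n) (u : CoeffIndex (fun _ : Fin n => d) → ℂ)
    (x : Fin n → ℂ) (a : Fin k)
    (h : ∀ α : {α : Fin n →₀ ℕ // α.degree = d}, ∀ l ∉ Set.range e, α.1 l ≠ 0 →
      u ⟨e a, α⟩ = 0 ∨ x l = 0) :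
    eval x (form (fun _ => d) u (e a)) =
      eval (x ∘ e) (form (fun _ => d) (u ∘ coeffIndexMap d e) a) := by
  simp only [form, map_sum, eval_monomial]
  symm
  refine Fintype.sum_of_injective
    (fun β : {β : Fin k →₀ ℕ // β.degree = d} => (coeffIndexMap d e ⟨a, β⟩).2)
    (fun β β' hβ => ?_) _ _ (fun α hα => ?_) fun β => ?_
  · exact Subtype.ext (Finsupp.mapDomain_injective e.injective (congrArg Subtype.val hβ))
  · have hl : ∃ l ∉ Set.range e, α.1 l ≠ 0 := by
      by_contra! hcon
      obtain ⟨β, hβ⟩ := (Finsupp.mem_range_mapDomain_iff e e.injective α.1).2 hcon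
      exact hα ⟨⟨β, by rw [← Finsupp.degree_mapDomain e, hβ, α.2]⟩, Subtype.ext hβ⟩
    obtain ⟨l, hl, hαl⟩ := hl
    rcases h α l hl hαl with h0 | h0
    · rw [h0, zero_mul]
    · rw [Finsupp.prod, Finset.prod_eq_zero (Finsupp.mem_support_iff.2 hαl)
        (by rw [h0, zero_pow hαl]), mul_zero]
  · simp only [coeffIndexMap, Function.comp_apply]
    rw [Finsupp.prod_mapDomain_index_inj e.injective]

theorem powCoeffs_comp_coeffIndexMap (e : Fin k ↪ Fin n) (s : Fin n → ℂ) :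
    powCoeffs (fun _ => d) s ∘ coeffIndexMap d e = powCoeffs (fun _ => d) (s ∘ e) := by
  ext ⟨a, β⟩
  simp only [powCoeffs, systemCoeffs, coeffIndexMap, Function.comp_apply, coeff_C_mul]
  rw [← coeff_rename_mapDomain e e.injective (X a ^ d), map_pow, rename_X]

/-- The system with coefficients `u` is triangular: the forms with index in the range of `e`
involve only the variables with index in the range of `e`. -/
def IsTriangular (e : Fin l ↪ Fin n) (u : CoeffIndex (fun _ : Fin n => d) → ℂ) : Prop :=
  ∀ c, c.1 ∈ Set.range e → (∃ i ∉ Set.range e, c.2.1 i ≠ 0) → u c = 0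

theorem isTriangular_powCoeffs (e : Fin l ↪ Fin n) (s : Fin n → ℂ) :
    IsTriangular (d := d) e (powCoeffs (fun _ => d) s) := by
  rintro ⟨j, α⟩ hj ⟨i, hi, hαi⟩
  simp only [powCoeffs, systemCoeffs, coeff_C_mul, coeff_X_pow]
  rw [if_neg, mul_zero]
  intro h
  have hij : j ≠ i := fun hij => hi (hij ▸ hj)
  exact hαi (by rw [← h, Finsupp.single_apply, if_neg hij])

/-- If the `eV`-part of the zero is nonzero, it solves the `eV`-block, whose forms see no other
variables. Otherwise the zero is supported on the range of `eU` and solves that block. -/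
theorem hasZero_or_hasZero_of_isTriangular {eU : Fin k ↪ Fin n} {eV : Fin l ↪ Fin n}
    (hUV : ∀ i, i ∈ Set.range eU ↔ i ∉ Set.range eV)
    {u : CoeffIndex (fun _ : Fin n => d) → ℂ} (hu : IsTriangular eV u)
    (hz : HasZero (fun _ => d) u) :
    HasZero (fun _ => d) (u ∘ coeffIndexMap d eU) ∨
      HasZero (fun _ => d) (u ∘ coeffIndexMap d eV) := by
  obtain ⟨x, hx, hxu⟩ := hz
  by_cases hV : x ∘ eV = 0
  · have hV' : ∀ i ∉ Set.range eU, x i = 0 := by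
      intro i hi
      rw [hUV, not_not] at hi
      obtain ⟨a, rfl⟩ := hi
      exact congrFun hV a
    refine Or.inl ⟨x ∘ eU, fun hU => hx (funext fun i => ?_), fun a => ?_⟩
    · by_cases hi : i ∈ Set.range eU
      · obtain ⟨a, rfl⟩ := hi
        exact congrFun hU a
      · exact hV' i hi
    · rw [← eval_form_coeffIndexMap eU u x a fun α l hl _ => Or.inr (hV' l hl)]
      exact hxu _
  · refine Or.inr ⟨x ∘ eV, hV, fun a => ?_⟩
    rw [← eval_form_coeffIndexMap eV u x a fun α l hl hαl =>
      Or.inl (hu ⟨eV a, α⟩ ⟨a, rfl⟩ ⟨l, hl, hαl⟩)]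
    exact hxu _

/-- The resultant of a triangular system is a product of powers of the resultants of its diagonal
blocks. -/
theorem IsResultant.eval_eq_of_isTriangular (hd : d ≠ 0) (hkl : k + l = n) (hk : k ≠ 0)
    (hl : l ≠ 0) {eU : Fin k ↪ Fin n} {eV : Fin l ↪ Fin n}
    (hUV : ∀ i, i ∈ Set.range eU ↔ i ∉ Set.range eV)
    {R : MvPolynomial (CoeffIndex fun _ : Fin n => d) ℂ}
    {RU : MvPolynomial (CoeffIndex fun _ : Fin k => d) ℂ}
    {RV : MvPolynomial (CoeffIndex fun _ : Fin l => d) ℂ}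
    (hR : IsResultant (fun _ => d) R) (hRU : IsResultant (fun _ => d) RU)
    (hRV : IsResultant (fun _ => d) RV)
    {u : CoeffIndex (fun _ : Fin n => d) → ℂ} (hu : IsTriangular eV u) :
    eval u R = eval (u ∘ coeffIndexMap d eU) RU ^ d ^ l *
      eval (u ∘ coeffIndexMap d eV) RV ^ d ^ k := by
  classical
  let free (c : CoeffIndex fun _ : Fin n => d) : Prop :=
    c.1 ∈ Set.range eV → ¬ ∃ i ∉ Set.range eV, c.2.1 i ≠ 0
  -- The restriction of `R` to triangular systems: the coefficients that must vanish there are set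
  -- to zero.
  let P : MvPolynomial (CoeffIndex fun _ : Fin n => d) ℂ :=
    aeval (fun c => if free c then X c else 0) R
  have hP : ∀ w, eval w P = eval (fun c => if free c then w c else 0) R := by
    intro w
    simp only [P]
    rw [eval_aeval_mvPolynomial]
    congr 2
    ext c
    split_ifs <;> simp
  have hPtri : ∀ w, IsTriangular eV w → eval w P = eval w R := by
    intro w hw
    rw [hP]
    congr 2
    ext c
    split_ifs with hc
    · rfl
    · simp only [free, Classical.not_imp, not_not] at hc
      exact (hw c hc.1 hc.2).symm
  have hfreeU : ∀ c, free (coeffIndexMap d eU c) := by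
    intro c hc
    exact absurd hc ((hUV _).1 ⟨c.1, rfl⟩)
  have hfreeV : ∀ c, free (coeffIndexMap d eV c) := by
    rintro c - ⟨i, hi, hne⟩
    exact hne (Finsupp.mapDomain_of_notMem_range _ _ hi)
  have hdvd : ∀ w, eval w P = 0 → eval w
      (rename (coeffIndexMap d eU) RU * rename (coeffIndexMap d eV) RV) = 0 := by
    intro w hw
    rw [hP, hR.eval_eq_zero_iff_hasZero] at hw
    rw [map_mul, eval_rename, eval_rename, mul_eq_zero, hRU.eval_eq_zero_iff_hasZero,
      hRV.eval_eq_zero_iff_hasZero]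
    have := hasZero_or_hasZero_of_isTriangular hUV (eV := eV) (by
      intro c hc hi
      exact if_neg fun hfree => hfree hc hi) hw
    simpa only [Function.comp_def, hfreeU, hfreeV, if_true] using this
  obtain ⟨N, hN⟩ := dvd_pow_of_eval_eq_zero_imp hdvd
  rw [mul_pow] at hN
  obtain ⟨P₁, P₂, h1, h2, hPP⟩ := exists_dvd_and_dvd_of_dvd_mul hN
  rw [dvd_prime_pow (prime_rename_of_injective (coeffIndexMap_injective d eU) hRU.prime)] at h1
  rw [dvd_prime_pow (prime_rename_of_injective (coeffIndexMap_injective d eV) hRV.prime)] at h2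
  obtain ⟨a, -, ha⟩ := h1
  obtain ⟨b, -, hb⟩ := h2
  obtain ⟨w, hw⟩ := (ha.mul_mul hb).symm
  obtain ⟨z, -, hz⟩ := MvPolynomial.isUnit_iff_eq_C_of_isReduced.1 w.isUnit
  have key : ∀ v, IsTriangular eV v → eval v R =
      eval (v ∘ coeffIndexMap d eU) RU ^ a * eval (v ∘ coeffIndexMap d eV) RV ^ b * z := by
    intro v hv
    rw [← hPtri v hv, hPP, ← hw, hz]
    simp only [map_mul, map_pow, eval_rename, eval_C]
  have hone : ∀ {m : ℕ} {Q : MvPolynomial (CoeffIndex fun _ : Fin m => d) ℂ},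
      IsResultant (fun _ => d) Q → eval (powCoeffs (fun _ => d) 1) Q = 1 := fun hQ => by
    rw [powCoeffs_one, hQ.normalized]
  have hz1 : z = 1 := by
    have := key _ (isTriangular_powCoeffs eV 1)
    rw [powCoeffs_comp_coeffIndexMap, powCoeffs_comp_coeffIndexMap, hone hR,
      show (1 : Fin n → ℂ) ∘ eU = 1 from rfl, show (1 : Fin n → ℂ) ∘ eV = 1 from rfl, hone hRU,
      hone hRV, one_pow, one_pow, one_mul, one_mul] at this
    exact this.symm
  have hcomp : ∀ {m m' : ℕ} (e : Fin m ↪ Fin n) (e' : Fin m' ↪ Fin n) (i : Fin m),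
      e i ∉ Set.range e' → (Function.update (1 : Fin n → ℂ) (e i) 2) ∘ e' = 1 := by
    intro m m' e e' i hi
    ext j
    have : e' j ≠ e i := fun h => hi ⟨j, h⟩
    simp [this]
  have hcomp' : ∀ {m : ℕ} (e : Fin m ↪ Fin n) (i : Fin m),
      (Function.update (1 : Fin n → ℂ) (e i) 2) ∘ e =
        Function.update (1 : Fin m → ℂ) i 2 := by
    intro m e i
    ext j
    simp [Function.update_apply]
  -- The scale factor `2` serves because its powers determine their exponents.
  have hexp : ∀ {m m' c : ℕ}, m ≠ 0 → m + m' = n →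
      (2 : ℂ) ^ d ^ (n - 1) = ((2 : ℂ) ^ d ^ (m - 1)) ^ c → c = d ^ m' := by
    intro m m' c hm hmm h
    rw [← pow_mul] at h
    have h' : (2 : ℕ) ^ d ^ (n - 1) = 2 ^ (d ^ (m - 1) * c) := by exact_mod_cast h
    have h'' := Nat.pow_right_injective le_rfl h'
    rw [show n - 1 = m - 1 + m' by omega, pow_add] at h''
    exact (Nat.eq_of_mul_eq_mul_left (Nat.pos_of_ne_zero (pow_ne_zero _ hd)) h'').symm
  have hau : a = d ^ l := by
    let i : Fin k := ⟨0, Nat.pos_of_ne_zero hk⟩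
    -- Scaling a form of the `eU`-block leaves the other block at the system of powers, which
    -- isolates the exponent `a`.
    have := key _ (isTriangular_powCoeffs eV (Function.update 1 (eU i) 2))
    rw [powCoeffs_comp_coeffIndexMap, powCoeffs_comp_coeffIndexMap, hcomp',
      hcomp eU eV i ((hUV _).1 ⟨i, rfl⟩), hR.eval_powCoeffs_update hd,
      hRU.eval_powCoeffs_update hd, hone hRV, one_pow, hz1, mul_one, mul_one] at this
    exact hexp hk hkl this
  have hbv : b = d ^ k := by
    let i : Fin l := ⟨0, Nat.pos_of_ne_zero hl⟩
    have := key _ (isTriangular_powCoeffs eV (Function.update 1 (eV i) 2))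
    rw [powCoeffs_comp_coeffIndexMap, powCoeffs_comp_coeffIndexMap, hcomp',
      hcomp eV eU i (fun h => (hUV _).1 h ⟨i, rfl⟩), hR.eval_powCoeffs_update hd,
      hRV.eval_powCoeffs_update hd, hone hRU, one_pow, hz1, mul_one, one_mul] at this
    exact hexp hl (by omega) this
  rw [key u hu, hau, hbv, hz1, mul_one]

end Triangular

/-! ### From tensors to coefficients of systems. -/

section Tensors

variable {n k m : ℕ}

theorem Tensor.coeff_forms (T : Tensor n m) (i : Fin n) (α : Fin n →₀ ℕ) :
    coeff α (T.forms i) = ∑ j : Fin (m - 1) → Fin n,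
      if ∑ l, Finsupp.single (j l) 1 = α then T i j else 0 := by
  simp only [Tensor.forms, coeff_sum, coeff_C_mul]
  refine Finset.sum_congr rfl fun j _ => ?_
  have : ∏ l, (X (j l) : MvPolynomial (Fin n) ℂ) =
      monomial (∑ l, Finsupp.single (j l) 1) 1 := by
    rw [monomial_sum_one]
    rfl
  rw [this, coeff_monomial]
  split_ifs <;> simp

theorem sum_single_apply_ne_zero {ι σ : Type*} [Fintype ι] (j : ι → σ) (l : ι) :
    (∑ l, Finsupp.single (j l) 1 : σ →₀ ℕ) (j l) ≠ 0 := by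
  rw [Finsupp.finsetSum_apply]
  have := Finset.single_le_sum (f := fun l' => Finsupp.single (j l') (1 : ℕ) (j l))
    (fun _ _ => Nat.zero_le _) (Finset.mem_univ l)
  rw [Finsupp.single_eq_same] at this
  omega

/-- A monomial in the variables from the range of `e` collects only entries whose indices all lie in
that range. -/
theorem Tensor.systemCoeffs_sub (T : Tensor n m) (e : Fin k ↪ Fin n) :
    systemCoeffs (fun _ => m - 1) (T.sub e).forms =
      systemCoeffs (fun _ => m - 1) T.forms ∘ coeffIndexMap (m - 1) e := by
  ext ⟨a, β⟩
  simp only [systemCoeffs, Function.comp_apply, coeffIndexMap, Tensor.coeff_forms]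
  refine Fintype.sum_of_injective (fun j : Fin (m - 1) → Fin k => e ∘ j)
    (fun j j' h => e.injective.comp_left h) _ _ (fun j hj => ?_) fun j => ?_
  · refine if_neg fun h => hj ?_
    have : ∀ l, ∃ b, e b = j l := by
      intro l
      by_contra hl
      have h0 := sum_single_apply_ne_zero j l
      rw [h] at h0
      exact h0 (Finsupp.mapDomain_of_notMem_range _ _ hl)
    choose b hb using this
    exact ⟨b, funext hb⟩
  · have : ∑ l, Finsupp.single ((e ∘ j) l) 1 =
        Finsupp.mapDomain e (∑ l, Finsupp.single (j l) 1 : Fin k →₀ ℕ) := by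
      rw [Finsupp.mapDomain_finsetSum]
      simp only [Finsupp.mapDomain_single, Function.comp_apply]
    simp only [this, (Finsupp.mapDomain_injective e.injective).eq_iff]
    rfl

end Tensors

end EDeterminant

/-! ### The product formula for E-determinants. -/

theorem theorem5p1 (m n k : ℕ) (hm : 2 ≤ m) (hk : 1 ≤ k) (hkn : k < n)
    (T : EDeterminant.Tensor n m)
    (hT : ∀ i : Fin n, k ≤ i.val → ∀ j : Fin (m - 1) → Fin n, (∃ l, (j l).val < k) → T i j = 0) :
    -- the resultants that define the three E-determinants exist and are unique
    (∃! R, EDeterminant.IsResultant (fun _ : Fin n => m - 1) R) ∧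
    (∃! R, EDeterminant.IsResultant (fun _ : Fin k => m - 1) R) ∧
    (∃! R, EDeterminant.IsResultant (fun _ : Fin (n - k) => m - 1) R) ∧
    -- the product formula
    EDeterminant.Edet T =
      EDeterminant.Edet (T.sub fun i : Fin k => ⟨i.val, by omega⟩) ^ (m - 1) ^ (n - k) *
      EDeterminant.Edet (T.sub fun i : Fin (n - k) => ⟨k + i.val, by omega⟩) ^ (m - 1) ^ k := by
  have hd : m - 1 ≠ 0 := by omega
  have hn0 : n ≠ 0 := by omega
  have hk0 : k ≠ 0 := by omega
  have hl0 : n - k ≠ 0 := by omega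
  refine ⟨EDeterminant.existsUnique_isResultant hn0 fun _ => hd,
    EDeterminant.existsUnique_isResultant hk0 fun _ => hd,
    EDeterminant.existsUnique_isResultant hl0 fun _ => hd, ?_⟩
  let eU : Fin k ↪ Fin n := ⟨fun i => ⟨i.val, by omega⟩, fun i j h => by
    simpa [Fin.ext_iff] using h⟩
  let eV : Fin (n - k) ↪ Fin n := ⟨fun i => ⟨k + i.val, by omega⟩, fun i j h => by
    simpa [Fin.ext_iff] using h⟩
  have hmemV : ∀ i, i ∈ Set.range eV ↔ k ≤ i.val := fun i =>
    ⟨by rintro ⟨a, rfl⟩; exact Nat.le_add_right _ _,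
      fun h => ⟨⟨i.val - k, by omega⟩, Fin.ext (Nat.add_sub_cancel' h)⟩⟩
  have hUV : ∀ i, i ∈ Set.range eU ↔ i ∉ Set.range eV := by
    intro i
    rw [hmemV, not_le]
    exact ⟨by rintro ⟨a, rfl⟩; exact a.2, fun h => ⟨⟨i.val, h⟩, rfl⟩⟩
  -- A monomial containing a variable of index below `k` collects only entries with such an index,
  -- which vanish in these rows by `hT`.
  have htri : EDeterminant.IsTriangular eV
      (EDeterminant.systemCoeffs (fun _ => m - 1) T.forms) := by
    rintro ⟨i, α⟩ hi ⟨l, hl, hαl⟩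
    rw [EDeterminant.systemCoeffs, EDeterminant.Tensor.coeff_forms]
    refine Finset.sum_eq_zero fun j _ => ?_
    split_ifs with h
    · refine hT i ((hmemV i).1 hi) j ?_
      by_contra! hcon
      refine hαl ?_
      change α.1 l = 0
      rw [← h, Finsupp.finsetSum_apply]
      refine Finset.sum_eq_zero fun b _ => Finsupp.single_eq_of_ne ?_
      rintro rfl
      exact hl ((hmemV _).2 (hcon b))
    · rfl
  have h := EDeterminant.IsResultant.eval_eq_of_isTriangular hd (by omega) hk0 hl0 hUV
    (EDeterminant.isResultant_resultantPoly hn0 fun _ => hd)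
    (EDeterminant.isResultant_resultantPoly hk0 fun _ => hd)
    (EDeterminant.isResultant_resultantPoly hl0 fun _ => hd) htri
  rw [← EDeterminant.Tensor.systemCoeffs_sub, ← EDeterminant.Tensor.systemCoeffs_sub] at h
  exact h
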